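/- Let $\mathbb{K}$ be $\mathbb{R}$ or $\mathbb{C}$. For a Banach space $E\neq\{0\}$ over $\mathbb{K}$ with dual $E^*$ and a bounded linear operator $T:E\to E$, the numerical radius of $T$ is $$v(T)=\sup\{|x^*(Tx)| : x\in E,\ x^*\in E^*,\ \|x\|=\|x^*\|=x^*(x)=1\},$$ and the numerical index of $E$ is $n(E)=\inf\{v(T) : T:E\to E \text{ bounded linear},\ \|T\|=1\}$. Let $c$ be the space of all convergent sequences in $\mathbb{K}$ with the supremum norm, let $c\oplus_\infty c\oplus_\infty c$ carry the norm $\|(x,y,z)\|=\max\{\|x\|,\|y\|,\|z\|\}$, and put $$X=\{(x,y,z)\in c\oplus_\infty c\oplus_\infty c : \lim x+\lim y+\lim z=0\}.$$ Then $X$ is a Banach space, $n(X)=1$ and $n(X^*)<1$. In particular, the numerical index of a Banach space can be strictly larger than that of its dual. -/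

import Mathlib

open Filter Topology
open scoped BoundedContinuousFunction

noncomputable section

namespace NumIndex

section Index

variable (𝕜 : Type*) [RCLike 𝕜] (E : Type*) [NormedAddCommGroup E] [NormedSpace 𝕜 E]

variable {𝕜 E} in
/-- The numerical range `V(T) = {x*(T x) : ‖x‖ = ‖x*‖ = x*(x) = 1}` of a bounded operator. -/
def numericalRange (T : E →L[𝕜] E) : Set 𝕜 :=
  {μ | ∃ (x : E) (f : StrongDual 𝕜 E), ‖x‖ = 1 ∧ ‖f‖ = 1 ∧ f x = 1 ∧ f (T x) = μ}

variable {𝕜 E} in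
/-- The numerical radius `v(T) = sup {|μ| : μ ∈ V(T)}`; this set is bounded by `‖T‖`, and it is
nonempty as soon as `E` is nontrivial. -/
def numericalRadius (T : E →L[𝕜] E) : ℝ :=
  sSup ((fun μ : 𝕜 => ‖μ‖) '' numericalRange T)

/-- The numerical index `n(E) = inf {v(T) : ‖T‖ = 1}`; this set is bounded below by `0`, and it is
nonempty as soon as `E` is nontrivial. -/
def numericalIndex : ℝ :=
  sInf {r : ℝ | ∃ T : E →L[𝕜] E, ‖T‖ = 1 ∧ numericalRadius T = r}

end Index

section Space

variable (𝕜 : Type*) [RCLike 𝕜]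

/-- The convergent scalar sequences, as a subspace of the
space `ℓ^∞` of bounded functions on the discrete space `ℕ`. -/
def convSeq : Submodule 𝕜 (ℕ →ᵇ 𝕜) where
  carrier := {x | ∃ l : 𝕜, Tendsto (fun n => x n) atTop (𝓝 l)}
  zero_mem' := ⟨0, by simp⟩
  add_mem' := by
    rintro x y ⟨l, hl⟩ ⟨m, hm⟩
    exact ⟨l + m, by simpa using hl.add hm⟩
  smul_mem' := by
    rintro a x ⟨l, hl⟩
    exact ⟨a * l, by simpa using hl.const_mul a⟩

/-- The Banach space `c`: the type of convergent sequences with the norm induced by `ℓ^∞`. -/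
def C : Type _ := convSeq 𝕜

instance : NormedAddCommGroup (C 𝕜) := inferInstanceAs (NormedAddCommGroup (convSeq 𝕜))

instance : NormedSpace 𝕜 (C 𝕜) := inferInstanceAs (NormedSpace 𝕜 (convSeq 𝕜))

variable {𝕜} in
/-- The `n`-th term of a convergent sequence. -/
def C.term (x : C 𝕜) (n : ℕ) : 𝕜 := x.1 n

variable {𝕜} in
theorem C.tendsto_limUnder (x : C 𝕜) : Tendsto x.term atTop (𝓝 (limUnder atTop x.term)) :=
  tendsto_nhds_limUnder x.2

/-- The limit functional `lim : c → 𝕜`. -/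
def C.lim : C 𝕜 →ₗ[𝕜] 𝕜 where
  toFun x := limUnder atTop x.term
  map_add' x y := Tendsto.limUnder_eq (x.tendsto_limUnder.add y.tendsto_limUnder)
  map_smul' a x := Tendsto.limUnder_eq (x.tendsto_limUnder.const_mul a)

/-- The space `X` of all `(x, y, z)` in the `ℓ^∞`-sum of three copies of `c` (the product carries
the maximum norm) with `lim x + lim y + lim z = 0`. -/
def X : Submodule 𝕜 (C 𝕜 × C 𝕜 × C 𝕜) where
  carrier := {p | C.lim 𝕜 p.1 + C.lim 𝕜 p.2.1 + C.lim 𝕜 p.2.2 = 0}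
  zero_mem' := by simp
  add_mem' := by
    intro p q hp hq
    simp only [Set.mem_ofPred_eq, Prod.fst_add, Prod.snd_add, map_add] at hp hq ⊢
    linear_combination hp + hq
  smul_mem' := by
    intro a p hp
    simp only [Set.mem_ofPred_eq, Prod.smul_fst, Prod.smul_snd, map_smul, smul_eq_mul] at hp ⊢
    linear_combination a * hp

end Space

end NumIndex

end

noncomputable section

namespace NumIndex

/-! ### Numerical index of a general normed space: criteria on the space and on its dual -/

section General

variable {𝕜 : Type*} [RCLike 𝕜] {E : Type*} [NormedAddCommGroup E] [NormedSpace 𝕜 E]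

/-! For `n(X) = 1`: a single coordinate of `x` in `X` can be changed without touching the others or
the limits. Making that coordinate unimodular turns a multiple of its functional into a support
functional, and convexity shows that `v(T)` dominates every coordinate of `T x`
(`numericalIndex_eq_one_of_coordinates`).

For the dual, the limit functionals satisfy `L 0 + L 1 + L 2 = 0`. Let `Φ` be a weak-star limit of
tails with limits `(1/2, 1/2, -1)`, and take the norm-one operator `ξ ↦ Φ ξ • u`, `u = (L 0 - L 1) /
2`. If `‖Φ ξ‖` is near 1, then `ξ` is near `-Φ ξ • L 2` (`norm_add_smul_le_of_bidual_limit`), so a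
state `Ξ` at `ξ` has `‖Ξ (L 0) + Ξ (L 1)‖ = ‖Ξ (L 2)‖` near 1. The parallelogram law then keeps `‖Ξ
u‖` away from 1. -/

theorem norm_le_of_mem_numericalRange {T : E →L[𝕜] E} {μ : 𝕜} (h : μ ∈ numericalRange T) :
    ‖μ‖ ≤ ‖T‖ := by
  obtain ⟨x, f, hx, hf, -, rfl⟩ := h
  calc ‖f (T x)‖ ≤ ‖f‖ * ‖T x‖ := f.le_opNorm _
    _ ≤ ‖f‖ * (‖T‖ * ‖x‖) := by gcongr; exact T.le_opNorm _
    _ = ‖T‖ := by rw [hx, hf]; ring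

theorem numericalRadius_nonneg (T : E →L[𝕜] E) : 0 ≤ numericalRadius T := by
  apply Real.sSup_nonneg
  rintro _ ⟨μ, -, rfl⟩
  exact norm_nonneg _

theorem numericalRadius_le_of_forall {T : E →L[𝕜] E} {c : ℝ} (hc : 0 ≤ c)
    (h : ∀ μ ∈ numericalRange T, ‖μ‖ ≤ c) : numericalRadius T ≤ c := by
  apply Real.sSup_le _ hc
  rintro _ ⟨μ, hμ, rfl⟩
  exact h μ hμ

theorem numericalRadius_le_norm (T : E →L[𝕜] E) : numericalRadius T ≤ ‖T‖ :=
  numericalRadius_le_of_forall (norm_nonneg _) fun _ => norm_le_of_mem_numericalRange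

theorem norm_le_numericalRadius {T : E →L[𝕜] E} {μ : 𝕜} (h : μ ∈ numericalRange T) :
    ‖μ‖ ≤ numericalRadius T := by
  refine le_csSup ⟨‖T‖, ?_⟩ ⟨μ, h, rfl⟩
  rintro _ ⟨ν, hν, rfl⟩
  exact norm_le_of_mem_numericalRange hν

theorem numericalIndex_le_numericalRadius {T : E →L[𝕜] E} (hT : ‖T‖ = 1) :
    numericalIndex 𝕜 E ≤ numericalRadius T := by
  refine csInf_le ⟨0, ?_⟩ ⟨T, hT, rfl⟩
  rintro _ ⟨S, -, rfl⟩
  exact numericalRadius_nonneg S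

/-- An affine function on the unit disc is dominated in norm by its values on the circle. -/
theorem exists_norm_eq_one_norm_affine_le (a b c : 𝕜) (hc : ‖c‖ ≤ 1) :
    ∃ u : 𝕜, ‖u‖ = 1 ∧ ‖a + c * b‖ ≤ ‖a + u * b‖ := by
  obtain ⟨v, hv, hvc⟩ : ∃ v : 𝕜, ‖v‖ = 1 ∧ c = ‖c‖ * v := by
    obtain ⟨w, hw, h⟩ := RCLike.exists_norm_eq_mul_self c
    have hw0 : w ≠ 0 := by rintro rfl; simp at hw
    refine ⟨w⁻¹, by simp [hw], ?_⟩
    rw [h]; field_simp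
  by_contra! H
  have h1 := H v hv
  have h2 := H (-v) (by simpa using hv)
  set s := ‖c‖ with hs
  have hs0 : 0 ≤ s := norm_nonneg c
  -- `c = s * v` lies on the segment from `-v` to `v`, so one of these endpoints does at least as
  -- well.
  have key : a + c * b = (((1 + s) / 2 : ℝ) : 𝕜) * (a + v * b) +
      (((1 - s) / 2 : ℝ) : 𝕜) * (a + -v * b) := by
    rw [hvc]; push_cast; ring
  have h3 : ‖a + c * b‖ ≤ (1 + s) / 2 * ‖a + v * b‖ + (1 - s) / 2 * ‖a + -v * b‖ := by
    conv_lhs => rw [key]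
    refine (norm_add_le _ _).trans ?_
    rw [norm_mul, norm_mul, RCLike.norm_ofReal, RCLike.norm_ofReal,
      abs_of_nonneg (by linarith), abs_of_nonneg (by linarith)]
  nlinarith

/-- A space whose norm is the supremum of a family of functionals, each of which has a vector
that it alone detects, has numerical index one. -/
theorem numericalIndex_eq_one_of_coordinates [Nontrivial E] {ι : Type*}
    (f : ι → StrongDual 𝕜 E) (e : ι → E)
    (hnorm : ∀ x : E, ∀ M : ℝ, 0 ≤ M → (‖x‖ ≤ M ↔ ∀ i, ‖f i x‖ ≤ M))
    (hself : ∀ i, f i (e i) = 1) (hne : ∀ i j, j ≠ i → f j (e i) = 0) :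
    numericalIndex 𝕜 E = 1 := by
  have hfx : ∀ i x, ‖f i x‖ ≤ ‖x‖ := fun i x => (hnorm x _ (norm_nonneg x)).1 le_rfl i
  have hf1 : ∀ i, ‖f i‖ ≤ 1 := fun i =>
    ContinuousLinearMap.opNorm_le_bound _ zero_le_one fun x => by simpa using hfx i x
  have main : ∀ T : E →L[𝕜] E, ‖T‖ = 1 → numericalRadius T = 1 := by
    intro T hT
    refine le_antisymm (hT ▸ numericalRadius_le_norm T) ?_
    rw [← hT]
    refine ContinuousLinearMap.opNorm_le_of_unit_norm (numericalRadius_nonneg T) fun x hx => ?_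
    refine (hnorm _ _ (numericalRadius_nonneg T)).2 fun i => ?_
    obtain ⟨u, hu, hle⟩ := exists_norm_eq_one_norm_affine_le
      (f i (T x) - f i x * f i (T (e i))) (f i (T (e i))) (f i x) ((hfx i x).trans hx.le)
    have hu0 : u ≠ 0 := by rintro rfl; simp at hu
    -- Only coordinate `i` changes: from `f i x` to the unimodular `u`.
    set y : E := x + (u - f i x) • e i with hy
    have hyi : f i y = u := by simp [hy, hself]
    have hTy : f i (T y) = f i (T x) - f i x * f i (T (e i)) + u * f i (T (e i)) := by
      simp only [hy, map_add, map_smul, smul_eq_mul]; ring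
    have hy1 : ‖y‖ = 1 := by
      apply le_antisymm
      · refine (hnorm _ _ zero_le_one).2 fun j => ?_
        by_cases hj : j = i
        · rw [hj, hyi, hu]
        · simpa [hy, hne i j hj] using (hfx j x).trans hx.le
      · rw [← hu, ← hyi]; exact hfx i y
    have hmem : (u⁻¹ • f i) (T y) ∈ numericalRange T := by
      refine ⟨y, u⁻¹ • f i, hy1, ?_, by simp [hyi, hu0], rfl⟩
      rw [norm_smul, norm_inv, hu, inv_one, one_mul]
      refine le_antisymm (hf1 i) ?_
      have := (f i).le_opNorm y
      rwa [hyi, hu, hy1, mul_one] at this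
    have := norm_le_numericalRadius hmem
    rw [smul_apply, norm_smul, norm_inv, hu, inv_one, one_mul, hTy] at this
    rw [sub_add_cancel] at hle
    exact hle.trans this
  have hset : {r : ℝ | ∃ T : E →L[𝕜] E, ‖T‖ = 1 ∧ numericalRadius T = r} = {1} := by
    ext r
    constructor
    · rintro ⟨T, hT, rfl⟩; exact main T hT
    · rintro rfl
      exact ⟨.id 𝕜 E, ContinuousLinearMap.norm_id, main _ ContinuousLinearMap.norm_id⟩
  rw [numericalIndex, hset, csInf_singleton]

/-- If the disc with centre `a` and radius `‖b‖ / 2` lies in the unit disc, then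
`‖a‖ + ‖b‖ / 2 ≤ 1`. -/
theorem norm_add_half_norm_le (a b : 𝕜) (h : ∀ t : 𝕜, ‖t‖ ≤ 1 / 2 → ‖a + t * b‖ ≤ 1) :
    ‖a‖ + ‖b‖ / 2 ≤ 1 := by
  obtain ⟨c, hc, hca⟩ := RCLike.exists_norm_eq_mul_self a
  obtain ⟨d, hd, hdb⟩ := RCLike.exists_norm_eq_mul_self b
  have hc0 : c ≠ 0 := by rintro rfl; simp at hc
  -- This `t` rotates `t * b` to the argument of `a`, so the two norms add.
  have := h (c⁻¹ * d / 2) (by simp [hc, hd])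
  have h2 : c * (a + c⁻¹ * d / 2 * b) = ((‖a‖ + ‖b‖ / 2 : ℝ) : 𝕜) := by
    rw [RCLike.ofReal_add, RCLike.ofReal_div, hca, hdb, RCLike.ofReal_ofNat]; field_simp
  rw [← one_mul ‖a + _‖, ← hc, ← norm_mul, h2, RCLike.norm_ofReal, hc] at this
  exact (le_abs_self _).trans this

/-- A bounded sequence has a weak-star limit in the bidual along some ultrafilter. -/
theorem exists_bidual_limit (y : ℕ → E) (hy : ∀ N, ‖y N‖ ≤ 1) :
    ∃ (F : Ultrafilter ℕ) (Φ : StrongDual 𝕜 (StrongDual 𝕜 E)),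
      (F : Filter ℕ) ≤ atTop ∧ ‖Φ‖ ≤ 1 ∧
        ∀ ξ : StrongDual 𝕜 E, Tendsto (fun N => ξ (y N)) F (𝓝 (Φ ξ)) := by
  set F : Ultrafilter ℕ := Ultrafilter.of atTop
  let g : ℕ → WeakDual 𝕜 (StrongDual 𝕜 E) := fun N =>
    StrongDual.toWeakDual (NormedSpace.inclusionInDoubleDual 𝕜 E (y N))
  have hg : ∀ N, g N ∈ WeakDual.toStrongDual ⁻¹'
      Metric.closedBall (0 : StrongDual 𝕜 (StrongDual 𝕜 E)) 1 := fun N => by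
    rw [Set.mem_preimage]
    refine (mem_closedBall_zero_iff (E := StrongDual 𝕜 (StrongDual 𝕜 E))).2 ?_
    exact (NormedSpace.double_dual_bound 𝕜 E _).trans (hy N)
  obtain ⟨Φ, hΦ, hlim⟩ := (WeakDual.isCompact_closedBall
    (0 : StrongDual 𝕜 (StrongDual 𝕜 E)) 1).ultrafilter_le_nhds (F.map g)
    (le_principal_iff.2 (Ultrafilter.mem_map.2 (Eventually.of_forall hg)))
  refine ⟨F, WeakDual.toStrongDual Φ, Ultrafilter.of_le _, ?_, fun ξ => ?_⟩
  · simpa using hΦ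
  · exact ((WeakDual.eval_continuous ξ).tendsto Φ).comp hlim

/-- Applying `ξ` to the vectors in `hcomb` and passing to the limit gives `‖Φ ξ + t * (ξ x + Φ ξ * L
x)‖ ≤ 1` for all `‖t‖ ≤ 1 / 2`; then `norm_add_half_norm_le` applies. -/
theorem norm_add_smul_le_of_bidual_limit {L : StrongDual 𝕜 E} {y : ℕ → E}
    (hcomb : ∀ x : E, ‖x‖ ≤ 1 → ∀ t : 𝕜, ‖t‖ ≤ 1 / 2 → ∀ ε : ℝ, 0 < ε →
      ∀ᶠ N in atTop, ‖(1 + t * L x) • y N + t • x‖ ≤ 1 + ε)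
    {F : Ultrafilter ℕ} {Φ : StrongDual 𝕜 (StrongDual 𝕜 E)} (hF : (F : Filter ℕ) ≤ atTop)
    (hΦ : ∀ ξ : StrongDual 𝕜 E, Tendsto (fun N => ξ (y N)) F (𝓝 (Φ ξ)))
    {ξ : StrongDual 𝕜 E} (hξ : ‖ξ‖ ≤ 1) (hle : ‖Φ ξ‖ ≤ 1) :
    ‖ξ + Φ ξ • L‖ ≤ 2 * (1 - ‖Φ ξ‖) := by
  refine ContinuousLinearMap.opNorm_le_of_unit_norm (by linarith) fun x hx => ?_
  suffices ‖Φ ξ‖ + ‖ξ x + Φ ξ * L x‖ / 2 ≤ 1 by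
    change ‖ξ x + Φ ξ * L x‖ ≤ _
    linarith
  refine norm_add_half_norm_le _ _ fun t ht => le_of_forall_pos_le_add fun ε hε => ?_
  have h1 : Tendsto (fun N => ‖(1 + t * L x) * ξ (y N) + t * ξ x‖) F
      (𝓝 ‖(1 + t * L x) * Φ ξ + t * ξ x‖) :=
    (((hΦ ξ).const_mul _).add_const _).norm
  rw [show Φ ξ + t * (ξ x + Φ ξ * L x) = (1 + t * L x) * Φ ξ + t * ξ x by ring]
  refine le_of_tendsto h1 (hF ?_)
  filter_upwards [hcomb x hx.le t ht ε hε] with N hN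
  have h2 := ξ.le_of_opNorm_le hξ ((1 + t * L x) • y N + t • x)
  rw [map_add, map_smul, map_smul, smul_eq_mul, smul_eq_mul, one_mul] at h2
  exact h2.trans hN

/-- A rank-one operator on the dual whose numerical radius is smaller than its norm, built from
three functionals of sum zero and a sequence in the unit ball on which the third one equals `-1`. -/
theorem numericalIndex_dual_lt_one {L : Fin 3 → StrongDual 𝕜 E} (hL : ∀ i, ‖L i‖ ≤ 1)
    (hL0 : L 0 + L 1 + L 2 = 0) {y : ℕ → E} (hy : ∀ N, ‖y N‖ ≤ 1) (hLy : ∀ N, L 2 (y N) = -1)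
    (hcomb : ∀ x : E, ‖x‖ ≤ 1 → ∀ t : 𝕜, ‖t‖ ≤ 1 / 2 → ∀ ε : ℝ, 0 < ε →
      ∀ᶠ N in atTop, ‖(1 + t * L 2 x) • y N + t • x‖ ≤ 1 + ε)
    {z : E} (hz : ‖z‖ ≤ 1) (hz0 : L 0 z = 1) (hz1 : L 1 z = -1) :
    numericalIndex 𝕜 (StrongDual 𝕜 E) < 1 := by
  obtain ⟨F, Φ, hF, hΦ1, hΦ⟩ := exists_bidual_limit (𝕜 := 𝕜) y hy
  have hΦ3 : Φ (L 2) = -1 := by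
    refine tendsto_nhds_unique (hΦ _) ?_
    simp [hLy]
  have hΦn : ‖Φ‖ = 1 := by
    refine le_antisymm hΦ1 ?_
    have h := Φ.le_opNorm_of_le (hL 2)
    rwa [hΦ3, norm_neg, norm_one, mul_one] at h
  set u : StrongDual 𝕜 E := (2⁻¹ : 𝕜) • (L 0 - L 1) with hu
  have hun : ‖u‖ = 1 := by
    apply le_antisymm
    · rw [hu, norm_smul, norm_inv, RCLike.norm_ofNat]
      have := (norm_sub_le (L 0) (L 1)).trans (add_le_add (hL 0) (hL 1))
      linarith
    · have h := u.le_opNorm_of_le hz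
      have h2 : u z = 1 := by
        change 2⁻¹ * (L 0 z - L 1 z) = 1
        rw [hz0, hz1]; norm_num
      rwa [h2, norm_one, mul_one] at h
  have hT : ‖Φ.smulRight u‖ = 1 := by
    rw [ContinuousLinearMap.norm_smulRight_apply, hΦn, hun, one_mul]
  refine (numericalIndex_le_numericalRadius hT).trans_lt (lt_of_le_of_lt
    (numericalRadius_le_of_forall (c := 99 / 100) (by norm_num) ?_) (by norm_num))
  rintro _ ⟨ξ, Ξ, hξ, hΞ, hΞξ, rfl⟩
  have hs : ‖Φ ξ‖ ≤ 1 := by simpa [hΦn, hξ] using Φ.le_opNorm ξ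
  have hkey := Ξ.le_opNorm_of_le (norm_add_smul_le_of_bidual_limit hcomb hF hΦ hξ.le hs)
  rw [map_add, map_smul, hΞξ, hΞ, one_mul, smul_eq_mul] at hkey
  have hw : ∀ i, ‖Ξ (L i)‖ ≤ 1 := fun i => by
    simpa [hΞ] using Ξ.le_opNorm_of_le (hL i)
  have hsum : Ξ (L 0) + Ξ (L 1) = -Ξ (L 2) := by
    have := congrArg Ξ hL0
    rw [map_add, map_add, map_zero] at this
    linear_combination this
  have hval : ‖Ξ (Φ.smulRight u ξ)‖ = ‖Φ ξ‖ * (‖Ξ (L 0) - Ξ (L 1)‖ / 2) := by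
    rw [ContinuousLinearMap.smulRight_apply, hu, map_smul, map_smul, map_sub, smul_eq_mul,
      smul_eq_mul, norm_mul, norm_mul, norm_inv, RCLike.norm_ofNat]
    ring
  rw [hval]
  -- Two scalars in the unit disc whose sum is not small cannot be almost 2 apart.
  have hpar := parallelogram_law_with_norm 𝕜 (Ξ (L 0)) (Ξ (L 1))
  rw [hsum, norm_neg] at hpar
  have h3 : 1 - ‖Φ ξ‖ * ‖Ξ (L 2)‖ ≤ 2 * (1 - ‖Φ ξ‖) := by
    have := norm_sub_le (1 + Φ ξ * Ξ (L 2)) (Φ ξ * Ξ (L 2))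
    rw [add_sub_cancel_right, norm_one, norm_mul] at this
    linarith
  have hsq : ‖Ξ (L 0) - Ξ (L 1)‖ ^ 2 ≤ 4 - ‖Ξ (L 2)‖ ^ 2 := by
    have h0 := pow_le_one₀ (n := 2) (norm_nonneg _) (hw 0)
    have h1 := pow_le_one₀ (n := 2) (norm_nonneg _) (hw 1)
    linarith
  have hd : ‖Ξ (L 0) - Ξ (L 1)‖ ≤ 2 := by
    linarith [norm_sub_le (Ξ (L 0)) (Ξ (L 1)), hw 0, hw 1]
  -- Either the factor `‖Φ ξ‖` is itself small, or `h3` forces `‖Ξ (L 2)‖ ≥ 1 / 2`, and `4 - 1 / 4 <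
  -- 1.98 ^ 2`.
  rcases le_total ‖Φ ξ‖ (3 / 4) with h | h
  · have := mul_le_mul h (div_le_one_of_le₀ hd zero_le_two) (by positivity) (by norm_num)
    linarith
  · have hw2 : 1 / 2 ≤ ‖Ξ (L 2)‖ := by
      have := mul_le_of_le_one_left (norm_nonneg (Ξ (L 2))) hs
      linarith
    have hw4 : (1 / 2 : ℝ) ^ 2 ≤ ‖Ξ (L 2)‖ ^ 2 := by gcongr
    have hd2 : ‖Ξ (L 0) - Ξ (L 1)‖ ≤ 198 / 100 :=
      (sq_le_sq₀ (norm_nonneg _) (by norm_num)).1 (by linarith)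
    have := mul_le_of_le_one_left (b := ‖Ξ (L 0) - Ξ (L 1)‖ / 2) (by positivity) hs
    linarith

end General

section Space

variable {𝕜 : Type*} [RCLike 𝕜]

/-! ### The space of convergent sequences -/

namespace C

theorem norm_le_iff (x : C 𝕜) {M : ℝ} (hM : 0 ≤ M) : ‖x‖ ≤ M ↔ ∀ n, ‖x.term n‖ ≤ M :=
  BoundedContinuousFunction.norm_le (f := x.1) hM

theorem norm_term_le (x : C 𝕜) (n : ℕ) : ‖x.term n‖ ≤ ‖x‖ :=
  (x.norm_le_iff (norm_nonneg x)).1 le_rfl n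

/-- The element of `C` given by a convergent sequence. -/
def ofTendsto (f : ℕ → 𝕜) (l : 𝕜) (h : Tendsto f atTop (𝓝 l)) : C 𝕜 :=
  ⟨BoundedContinuousFunction.mkOfDiscrete f
    (Metric.isBounded_range_iff.1 (Metric.isBounded_range_of_tendsto f h)).choose
    (Metric.isBounded_range_iff.1 (Metric.isBounded_range_of_tendsto f h)).choose_spec, l, h⟩

theorem lim_eq {x : C 𝕜} {l : 𝕜} (h : Tendsto x.term atTop (𝓝 l)) : C.lim 𝕜 x = l :=
  h.limUnder_eq

@[simp] theorem lim_ofTendsto (f : ℕ → 𝕜) (l : 𝕜) (h : Tendsto f atTop (𝓝 l)) :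
    C.lim 𝕜 (ofTendsto f l h) = l :=
  lim_eq (x := ofTendsto f l h) h

theorem tendsto_lim (x : C 𝕜) : Tendsto x.term atTop (𝓝 (C.lim 𝕜 x)) := x.tendsto_limUnder

theorem norm_lim_le (x : C 𝕜) : ‖C.lim 𝕜 x‖ ≤ ‖x‖ :=
  le_of_tendsto x.tendsto_lim.norm (Eventually.of_forall x.norm_term_le)

/-- The limit functional as a bounded functional. -/
def limCLM : StrongDual 𝕜 (C 𝕜) :=
  (C.lim 𝕜).mkContinuous 1 fun x => by simpa using x.norm_lim_le

/-- Evaluation at the `n`-th term as a bounded functional. -/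
def termCLM (n : ℕ) : StrongDual 𝕜 (C 𝕜) :=
  LinearMap.mkContinuous
    { toFun := fun x => x.term n
      map_add' := fun _ _ => rfl
      map_smul' := fun _ _ => rfl } 1 fun x => (x.norm_term_le n).trans_eq (one_mul _).symm

theorem isClosed_convSeq : IsClosed (convSeq 𝕜 : Set (ℕ →ᵇ 𝕜)) := by
  refine isClosed_of_closure_subset fun x hx => ?_
  suffices CauchySeq fun n => x n from cauchySeq_tendsto_of_complete this
  rw [Metric.cauchySeq_iff']
  intro ε hε
  obtain ⟨y, ⟨l, hl⟩, hxy⟩ := Metric.mem_closure_iff.1 hx (ε / 3) (by positivity)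
  obtain ⟨N, hN⟩ := Metric.cauchySeq_iff'.1 hl.cauchySeq (ε / 3) (by positivity)
  refine ⟨N, fun n hn => ?_⟩
  have h1 := (BoundedContinuousFunction.dist_coe_le_dist (f := x) (g := y) n).trans_lt hxy
  have h2 := (BoundedContinuousFunction.dist_coe_le_dist (f := x) (g := y) N).trans_lt hxy
  have h3 := hN n hn
  rw [dist_comm] at h2
  linarith [dist_triangle4 (x n) (y n) (y N) (x N)]

instance : CompleteSpace (C 𝕜) :=
  (isClosed_convSeq (𝕜 := 𝕜)).completeSpace_coe

end C

/-! ### The space `X`: coordinates, limits and tails -/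

namespace X

theorem isClosed : IsClosed (X 𝕜 : Set (C 𝕜 × C 𝕜 × C 𝕜)) := by
  have : (X 𝕜 : Set (C 𝕜 × C 𝕜 × C 𝕜)) =
      {p | C.limCLM p.1 + C.limCLM p.2.1 + C.limCLM p.2.2 = 0} := rfl
  rw [this]
  exact isClosed_eq (by fun_prop) continuous_const

instance : CompleteSpace (X 𝕜) := (isClosed (𝕜 := 𝕜)).completeSpace_coe

/-- The `i`-th component of a triple in `X`. -/
def comp (i : Fin 3) : X 𝕜 →L[𝕜] C 𝕜 :=
  ![.fst 𝕜 _ _, (ContinuousLinearMap.fst 𝕜 _ _).comp (.snd 𝕜 _ _),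
    (ContinuousLinearMap.snd 𝕜 _ _).comp (.snd 𝕜 _ _)] i ∘L (X 𝕜).subtypeL

/-- The coordinate functional `(x₀, x₁, x₂) ↦ xᵢ(n)`. -/
def coord (p : Fin 3 × ℕ) : StrongDual 𝕜 (X 𝕜) := C.termCLM p.2 ∘L comp p.1

theorem coord_apply (p : Fin 3 × ℕ) (x : X 𝕜) : coord p x = (comp p.1 x).term p.2 := rfl

/-- The limit functional `(x₀, x₁, x₂) ↦ lim xᵢ`. -/
def limComp (i : Fin 3) : StrongDual 𝕜 (X 𝕜) := C.limCLM ∘L comp i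

theorem tendsto_coord (i : Fin 3) (x : X 𝕜) :
    Tendsto (fun n => coord (i, n) x) atTop (𝓝 (limComp i x)) :=
  (comp i x).tendsto_lim

theorem limComp_sum (x : X 𝕜) : limComp 0 x + limComp 1 x + limComp 2 x = 0 := x.2

theorem norm_le_iff (x : X 𝕜) (M : ℝ) (hM : 0 ≤ M) : ‖x‖ ≤ M ↔ ∀ p, ‖coord p x‖ ≤ M := by
  have h : ‖x‖ ≤ M ↔ ‖comp 0 x‖ ≤ M ∧ ‖comp 1 x‖ ≤ M ∧ ‖comp 2 x‖ ≤ M := by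
    change ‖(x : C 𝕜 × C 𝕜 × C 𝕜)‖ ≤ M ↔ _
    rw [Prod.norm_def, Prod.norm_def, sup_le_iff, sup_le_iff]
    rfl
  simp only [h, C.norm_le_iff _ hM, Prod.forall, Fin.forall_fin_succ, coord_apply]
  simp

theorem norm_coord_le (p : Fin 3 × ℕ) (x : X 𝕜) : ‖coord p x‖ ≤ ‖x‖ :=
  (norm_le_iff x _ (norm_nonneg x)).1 le_rfl p

theorem norm_limComp_apply_le (i : Fin 3) (x : X 𝕜) : ‖limComp i x‖ ≤ ‖x‖ :=
  le_of_tendsto (tendsto_coord i x).norm (Eventually.of_forall fun _ => norm_coord_le _ x)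

theorem norm_limComp_le (i : Fin 3) : ‖(limComp i : StrongDual 𝕜 (X 𝕜))‖ ≤ 1 :=
  ContinuousLinearMap.opNorm_le_bound _ zero_le_one fun x => by
    simpa using norm_limComp_apply_le i x

/-- The element of `X` given by three sequences whose limits add up to zero. -/
def ofTendsto (f : Fin 3 → ℕ → 𝕜) (l : Fin 3 → 𝕜) (h : ∀ i, Tendsto (f i) atTop (𝓝 (l i)))
    (hl : l 0 + l 1 + l 2 = 0) : X 𝕜 :=
  ⟨(C.ofTendsto (f 0) _ (h 0), C.ofTendsto (f 1) _ (h 1), C.ofTendsto (f 2) _ (h 2)), by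
    change C.lim 𝕜 (C.ofTendsto (f 0) _ (h 0)) + C.lim 𝕜 (C.ofTendsto (f 1) _ (h 1)) +
      C.lim 𝕜 (C.ofTendsto (f 2) _ (h 2)) = 0
    rw [C.lim_ofTendsto, C.lim_ofTendsto, C.lim_ofTendsto, hl]⟩

section

variable (f : Fin 3 → ℕ → 𝕜) (l : Fin 3 → 𝕜) (h : ∀ i, Tendsto (f i) atTop (𝓝 (l i)))
  (hl : l 0 + l 1 + l 2 = 0)

@[simp] theorem coord_ofTendsto (p : Fin 3 × ℕ) : coord p (ofTendsto f l h hl) = f p.1 p.2 := by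
  obtain ⟨i, n⟩ := p
  fin_cases i <;> rfl

@[simp] theorem limComp_ofTendsto (i : Fin 3) : limComp i (ofTendsto f l h hl) = l i := by
  refine tendsto_nhds_unique (tendsto_coord i _) ?_
  simpa using h i

end

/-- The vector with a single nonzero term, equal to one. -/
def unitVec (p : Fin 3 × ℕ) : X 𝕜 :=
  ofTendsto (fun i n => if (i, n) = p then 1 else 0) 0
    (fun i => tendsto_const_nhds.congr' (by
      filter_upwards [eventually_gt_atTop p.2] with n hn
      rw [if_neg]
      · rfl
      · rintro rfl
        exact lt_irrefl _ hn)) (by simp)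

theorem coord_unitVec_self (p : Fin 3 × ℕ) : coord p (unitVec p : X 𝕜) = 1 := by
  simp [unitVec]

theorem coord_unitVec_of_ne (p q : Fin 3 × ℕ) (h : q ≠ p) : coord q (unitVec p : X 𝕜) = 0 := by
  simp [unitVec, h]

instance : Nontrivial (X 𝕜) :=
  ⟨unitVec (0, 0), 0, fun h => by simpa [h] using coord_unitVec_self (𝕜 := 𝕜) (0, 0)⟩

theorem numericalIndex_eq_one : numericalIndex 𝕜 (X 𝕜) = 1 :=
  numericalIndex_eq_one_of_coordinates coord unitVec norm_le_iff coord_unitVec_self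
    coord_unitVec_of_ne

/-- The triple of sequences that vanish before `N` and are constant, with value `l i`, from `N`
on. -/
def tail (l : Fin 3 → 𝕜) (hl : l 0 + l 1 + l 2 = 0) (N : ℕ) : X 𝕜 :=
  ofTendsto (fun i n => if N ≤ n then l i else 0) l
    (fun i => tendsto_const_nhds.congr' (by
      filter_upwards [eventually_ge_atTop N] with n hn
      rw [if_pos hn])) hl

theorem coord_tail (l : Fin 3 → 𝕜) (hl : l 0 + l 1 + l 2 = 0) (N : ℕ) (p : Fin 3 × ℕ) :
    coord p (tail l hl N) = if N ≤ p.2 then l p.1 else 0 := by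
  simp [tail]

theorem limComp_tail (l : Fin 3 → 𝕜) (hl : l 0 + l 1 + l 2 = 0) (N : ℕ) (i : Fin 3) :
    limComp i (tail l hl N) = l i := by
  simp [tail]

theorem norm_tail_le (l : Fin 3 → 𝕜) (hl : l 0 + l 1 + l 2 = 0) (N : ℕ) (h1 : ∀ i, ‖l i‖ ≤ 1) :
    ‖tail l hl N‖ ≤ 1 := by
  refine (norm_le_iff _ _ zero_le_one).2 fun p => ?_
  rw [coord_tail]
  split_ifs
  · exact h1 _
  · simp

/-- The tails with limits `(1/2, 1/2, -1)`. -/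
def halfTail (N : ℕ) : X 𝕜 :=
  tail ![1 / 2, 1 / 2, -1] (by simp; norm_num) N

theorem norm_halfTail_le (N : ℕ) : ‖(halfTail N : X 𝕜)‖ ≤ 1 :=
  norm_tail_le _ _ _ fun i => by fin_cases i <;> simp; all_goals norm_num

/-- The factor `1 + t * limComp 2 x` keeps the third limit exactly `-1`. As the limits of `x` sum to
zero, the other two become `1/2 ± t * (r 0 - r 1) / 2`, which stay in the unit disc. -/
theorem norm_combination_halfTail_le {x : X 𝕜} (hx : ‖x‖ ≤ 1) {t : 𝕜} (ht : ‖t‖ ≤ 1 / 2)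
    {ε : ℝ} (hε : 0 < ε) :
    ∀ᶠ N in atTop, ‖(1 + t * limComp 2 x) • halfTail N + t • x‖ ≤ 1 + ε := by
  have hev : ∀ᶠ N in atTop, ∀ n ≥ N, ∀ i, ‖coord (i, n) x - limComp i x‖ ≤ ε := by
    refine eventually_forall_ge_atTop.2 (eventually_all.2 fun i => ?_)
    filter_upwards [Metric.tendsto_nhds.1 (tendsto_coord i x) ε hε] with n hn
    rw [← dist_eq_norm]; exact hn.le
  filter_upwards [hev] with N hN
  refine (norm_le_iff _ _ (by positivity)).2 ?_
  rintro ⟨i, n⟩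
  rw [map_add, map_smul, map_smul, halfTail, coord_tail, smul_eq_mul, smul_eq_mul]
  -- From `N` on, the terms of `x` are within `ε` of their limits; before `N` the tail vanishes and
  -- only `t • x` remains.
  split_ifs with h
  · set r : Fin 3 → 𝕜 := fun i => limComp i x with hr
    have hr1 : ∀ i, ‖r i‖ ≤ 1 := fun i => (norm_limComp_apply_le i x).trans hx
    have hsum : r 0 + r 1 + r 2 = 0 := limComp_sum x
    have hdiff : ‖t * (r 0 - r 1) / 2‖ ≤ 1 / 2 := by
      rw [norm_div, norm_mul, RCLike.norm_ofNat]
      have := (norm_sub_le (r 0) (r 1)).trans (add_le_add (hr1 0) (hr1 1))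
      nlinarith [norm_nonneg t, norm_nonneg (r 0 - r 1)]
    have hlim : ‖(1 + t * r 2) * (![1 / 2, 1 / 2, -1] : Fin 3 → 𝕜) i + t * r i‖ ≤ 1 := by
      have hhalf : ‖(1 / 2 : 𝕜)‖ = 1 / 2 := by simp
      fin_cases i
      · have : (1 + t * r 2) * (1 / 2) + t * r 0 = 1 / 2 + t * (r 0 - r 1) / 2 := by
          linear_combination t / 2 * hsum
        change ‖(1 + t * r 2) * (1 / 2) + t * r 0‖ ≤ 1
        rw [this]
        linarith [norm_add_le (1 / 2 : 𝕜) (t * (r 0 - r 1) / 2)]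
      · have : (1 + t * r 2) * (1 / 2) + t * r 1 = 1 / 2 - t * (r 0 - r 1) / 2 := by
          linear_combination t / 2 * hsum
        change ‖(1 + t * r 2) * (1 / 2) + t * r 1‖ ≤ 1
        rw [this]
        linarith [norm_sub_le (1 / 2 : 𝕜) (t * (r 0 - r 1) / 2)]
      · change ‖(1 + t * r 2) * (-1) + t * r 2‖ ≤ 1
        rw [show (1 + t * r 2) * (-1) + t * r 2 = -1 by ring]
        simp
    have hd : ‖t * (coord (i, n) x - r i)‖ ≤ ε := by
      rw [norm_mul]
      nlinarith [hN n h i, norm_nonneg t, norm_nonneg (coord (i, n) x - r i)]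
    calc _ = ‖((1 + t * r 2) * (![1 / 2, 1 / 2, -1] : Fin 3 → 𝕜) i + t * r i) +
          t * (coord (i, n) x - r i)‖ := by congr 1; ring
      _ ≤ 1 + ε := (norm_add_le _ _).trans (add_le_add hlim hd)
  · rw [mul_zero, zero_add, norm_mul]
    nlinarith [norm_nonneg t, norm_nonneg (coord (i, n) x), norm_coord_le (i, n) x]

theorem numericalIndex_dual_lt_one : numericalIndex 𝕜 (StrongDual 𝕜 (X 𝕜)) < 1 :=
  NumIndex.numericalIndex_dual_lt_one (L := limComp) norm_limComp_le
    (ContinuousLinearMap.ext limComp_sum) norm_halfTail_le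
    (fun N => by simp [halfTail, limComp_tail])
    (fun _ hx _ ht _ hε => norm_combination_halfTail_le hx ht hε)
    -- The constant triple `(1, -1, 0)` is where `(L 0 - L 1) / 2` attains its norm.
    (norm_tail_le ![1, -1, 0] (by simp) 0 fun i => by fin_cases i <;> simp)
    (by simp [limComp_tail]) (by simp [limComp_tail])

end X

end Space

end NumIndex

end

theorem mainTheorem1 (𝕜 : Type*) [RCLike 𝕜] :
    CompleteSpace (NumIndex.X 𝕜) ∧
      NumIndex.numericalIndex 𝕜 (NumIndex.X 𝕜) = 1 ∧
      NumIndex.numericalIndex 𝕜 (StrongDual 𝕜 (NumIndex.X 𝕜)) < 1 :=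
  ⟨inferInstance, NumIndex.X.numericalIndex_eq_one, NumIndex.X.numericalIndex_dual_lt_one⟩
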